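/- Let $p$ be a prime, $n\ge 1$, $q=p^n$, and let $\mathbb{F}$ be a field with $q$ elements. Let $G=\mathrm{Aut}(\mathbb{F}(x)/\mathbb{F})$ be the group of field automorphisms of the rational function field $\mathbb{F}(x)$ that fix $\mathbb{F}$ pointwise, and let $E$ be the fixed field of $G$. The group $G$ is finite; put $m=q^2-1$ and $$f_m=\sum_{\varphi\in G}\varphi(x)^m\in\mathbb{F}(x).$$ Let $\theta_i=2$ if $i\in\{q,2q,\ldots,q^2\}$ and $\theta_i=1$ otherwise, and let $$g=\sum_{i=0}^{q(q+1)}\theta_i\,x^{i(q-1)},\qquad h=\sum_{i=1}^{q}x^{iq(q-1)}$$ in $\mathbb{F}[x]$. Then $g$ and $h$ are relatively prime, $h\neq 0$, and $f_m=g/h$. Moreover $E=\mathbb{F}(f_m)$, and this generator $f_m$ of $E$ lies in the subfield $\mathbb{F}_p(x)$ of $\mathbb{F}(x)$, where $\mathbb{F}_p$ is the prime field of $\mathbb{F}$. -/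

import Mathlib

open Polynomial IntermediateField

noncomputable section

/-- The group `G = Aut(F(x)/F)` of field automorphisms of `F(x)` fixing `F` pointwise. -/
abbrev RatAut (F : Type*) [Field F] : Type _ := RatFunc F ≃ₐ[F] RatFunc F

/-- The fixed field `E` of `G = Aut(F(x)/F)`, as a field between `F` and `F(x)`. -/
def fixedE (F : Type*) [Field F] : IntermediateField F (RatFunc F) :=
  IntermediateField.fixedField (⊤ : Subgroup (RatAut F))

/-- `f_k = ∑_{φ ∈ G} φ(x)^k`. (`∑ᶠ` is the sum over all of `G` when `G` is finite; the
finiteness of `G` is part of the conclusion of the theorem.) -/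
def fSum (F : Type*) [Field F] (k : ℕ) : RatFunc F :=
  ∑ᶠ φ : RatAut F, φ RatFunc.X ^ k

/-- `θ_i = 2` for `i = q, 2q, …, q^2`, and `θ_i = 1` otherwise. -/
def theta (q i : ℕ) : ℕ :=
  if i ∈ (Finset.Icc 1 q).image (fun j => j * q) then 2 else 1

/-- `g = ∑_{i=0}^{q(q+1)} θ_i x^{i(q-1)}`. -/
def gPoly (F : Type*) [Field F] (q : ℕ) : F[X] :=
  ∑ i ∈ Finset.range (q * (q + 1) + 1), C (theta q i : F) * X ^ (i * (q - 1))

/-- `h = ∑_{i=1}^{q} x^{iq(q-1)}`. -/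
def hPoly (F : Type*) [Field F] (q : ℕ) : F[X] :=
  ∑ i ∈ Finset.Icc 1 q, X ^ (i * q * (q - 1))

end

/-!
Write `q` for the number of elements of `F` and `L = x ^ q - x`. The whole theorem rests on the
factored form
`f = (1 + L ^ (q - 1)) ^ (q + 1) / L ^ (q (q - 1))`, `m = q ^ 2 - 1`, `f = f_m`
(`fSum_eq_pow_div_pow`), whose numerator and denominator are visibly coprime.

By the degree formula `[F(x) : F(f)] = max (deg num f) (deg denom f)`, the images of `x` under `G`
are the rational functions of degree one. These are the `u (y + a)` with `u ∈ Fˣ`, `a ∈ F` and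
`y = x` or `y = 1 / (x + d)` (`ratAutEquiv`), so `G` has `(q - 1) q (q + 1)` elements. As
`u ^ m = 1` and `q - 1 = -1` in `F`, `f = -∑ y, ∑ a, (y + a) ^ m`. The inner sum is computed from
`(y + a) ^ (q ^ 2) = y ^ (q ^ 2) + a` and the partial fractions
`∑ a, 1 / (y + a) = -1 / (y ^ q - y)`: it is `-(1 + (y ^ q - y) ^ (q - 1))` (`sum_add_algebraMap_pow`). For `y = 1 / (x + d)` one has
`y ^ q - y = -L / (x + d) ^ (q + 1)`, and the sum over `d` is evaluated by partial fractions again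
(`sum_inv_add_algebraMap_pow`).

In terms of `v = x ^ (q - 1)`, additivity of the Frobenius map and geometric sums give
`L ^ (q - 1) = v + ⋯ + v ^ q`; expanding the powers gives `g` and `h` (`gPoly_eq`, `hPoly_eq`).
In the product `(∑ j ≤ q, v ^ j) (∑ k ≤ q, v ^ (q k))` exactly the exponents `q, 2q, …, q ^ 2` arise
twice, which explains `θ`.

Finally `F(f) ≤ E`, while `[F(x) : F(f)] = deg g = q ^ 3 - q = |G| = [F(x) : E]` by the degree
formula and Artin's theorem, so `E = F(f)`; and the factored form has its coefficients in the prime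
field.
-/

/-! ### Power sums over translates by a finite field -/

section Translates

variable {F : Type*} [Field F] [Fintype F]

lemma add_pow_fintype_card {R : Type*} [CommRing R] [Algebra F R] (x y : R) :
    (x + y) ^ Fintype.card F = x ^ Fintype.card F + y ^ Fintype.card F :=
  map_add (FiniteField.frobeniusAlgHom F R) x y

lemma sub_pow_fintype_card {R : Type*} [CommRing R] [Algebra F R] (x y : R) :
    (x - y) ^ Fintype.card F = x ^ Fintype.card F - y ^ Fintype.card F :=
  map_sub (FiniteField.frobeniusAlgHom F R) x y

lemma sum_pow_fintype_card {R ι : Type*} [CommRing R] [Algebra F R] (s : Finset ι) (f : ι → R) :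
    (∑ i ∈ s, f i) ^ Fintype.card F = ∑ i ∈ s, f i ^ Fintype.card F :=
  map_sum (FiniteField.frobeniusAlgHom F R) f s

lemma algebraMap_pow_fintype_card (R : Type*) [CommRing R] [Algebra F R] (a : F) :
    algebraMap F R a ^ Fintype.card F = algebraMap F R a := by
  rw [← map_pow, FiniteField.pow_card]

variable (F) in
lemma cast_fintype_card_eq_zero (R : Type*) [CommRing R] [Algebra F R] :
    (Fintype.card F : R) = 0 := by
  rw [← map_natCast (algebraMap F R), FiniteField.cast_card_eq_zero, map_zero]

variable {K : Type*} [Field K] [Algebra F K] {y : K}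

lemma add_algebraMap_ne_zero (hy : y ^ Fintype.card F ≠ y) (b : F) : y + algebraMap F K b ≠ 0 := by
  intro h
  apply hy
  rw [eq_neg_of_add_eq_zero_left h, ← map_neg, algebraMap_pow_fintype_card]

/-- The partial fraction expansion of `1 / (y ^ q - y)`: this is the logarithmic derivative of
`∏ b, (y + b) = y ^ q - y`, whose derivative is `-1`. -/
lemma sum_inv_add_algebraMap (hy : y ^ Fintype.card F ≠ y) :
    ∑ b : F, (y + algebraMap F K b)⁻¹ = -(y ^ Fintype.card F - y)⁻¹ := by
  classical
  have hs : (X ^ Fintype.card F - X : F[X]).Splits := by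
    rw [splits_iff_card_roots, FiniteField.roots_X_pow_card_sub_X,
      FiniteField.X_pow_card_sub_X_natDegree_eq F Fintype.one_lt_card]
    rfl
  have hr := hs.roots_map (algebraMap F K)
  rw [FiniteField.roots_X_pow_card_sub_X] at hr
  have he : ((X ^ Fintype.card F - X : F[X]).map (algebraMap F K)).eval y
      = y ^ Fintype.card F - y := by simp
  have := (hs.map (algebraMap F K)).eval_derivative_div_eval_of_ne_zero
    (x := y) (by rw [he]; exact sub_ne_zero.2 hy)
  rw [he, hr] at this
  simp only [Polynomial.map_sub, Polynomial.map_pow, map_X, derivative_sub, derivative_X_pow,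
    derivative_X, cast_fintype_card_eq_zero F K, C_0, zero_mul, zero_sub, eval_neg, eval_one,
    Multiset.map_map, Function.comp_apply] at this
  rw [← one_div, ← neg_div, this, ← Equiv.sum_comp (Equiv.neg F)]
  simp [← sub_eq_add_neg]

lemma sum_div_add_algebraMap (hy : y ^ Fintype.card F ≠ y) :
    ∑ b : F, algebraMap F K b / (y + algebraMap F K b) = y / (y ^ Fintype.card F - y) := by
  have h (b : F) : algebraMap F K b / (y + algebraMap F K b)
      = 1 - y * (y + algebraMap F K b)⁻¹ := by
    have := add_algebraMap_ne_zero hy b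
    field_simp
    ring
  simp only [h, Finset.sum_sub_distrib, ← Finset.mul_sum, sum_inv_add_algebraMap hy]
  simp [cast_fintype_card_eq_zero F K, div_eq_mul_inv]

lemma add_algebraMap_pow_card_sq (y : K) (b : F) :
    (y + algebraMap F K b) ^ Fintype.card F ^ 2 = y ^ Fintype.card F ^ 2 + algebraMap F K b := by
  simp only [sq, pow_mul, add_pow_fintype_card, algebraMap_pow_fintype_card]

lemma add_algebraMap_pow_card_sq_sub_one (hy : y ^ Fintype.card F ≠ y) (b : F) :
    (y + algebraMap F K b) ^ (Fintype.card F ^ 2 - 1)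
      = (y ^ Fintype.card F ^ 2 + algebraMap F K b) / (y + algebraMap F K b) := by
  rw [eq_div_iff (add_algebraMap_ne_zero hy b), ← add_algebraMap_pow_card_sq, pow_sub_one_mul]
  exact pow_ne_zero _ Fintype.card_ne_zero

lemma pow_card_sq_sub_self (y : K) :
    y ^ Fintype.card F ^ 2 - y
      = (y ^ Fintype.card F - y) ^ Fintype.card F + (y ^ Fintype.card F - y) := by
  rw [sub_pow_fintype_card]; ring

/-- Each summand is `(y ^ (q ^ 2) + b) / (y + b)`, so the sum reduces to partial fractions at `y`. -/
lemma sum_add_algebraMap_pow (hy : y ^ Fintype.card F ≠ y) :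
    ∑ b : F, (y + algebraMap F K b) ^ (Fintype.card F ^ 2 - 1)
      = -(1 + (y ^ Fintype.card F - y) ^ (Fintype.card F - 1)) := by
  have hL := sub_ne_zero.2 hy
  have h1 := pow_sub_one_mul (Fintype.card_ne_zero (α := F)) (y ^ Fintype.card F - y)
  have h2 := pow_card_sq_sub_self (F := F) y
  simp only [add_algebraMap_pow_card_sq_sub_one hy, add_div, Finset.sum_add_distrib,
    sum_div_add_algebraMap hy]
  simp only [div_eq_mul_inv, ← Finset.mul_sum, sum_inv_add_algebraMap hy]
  field_simp
  linear_combination -h2 + h1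

/-- Each summand is `(y + b) / (y ^ (q ^ 2) + b)`, so the sum reduces to partial fractions at
`y ^ (q ^ 2)`. -/
lemma sum_inv_add_algebraMap_pow (hy : y ^ Fintype.card F ≠ y) :
    ∑ b : F, ((y + algebraMap F K b) ^ (Fintype.card F ^ 2 - 1))⁻¹
      = (1 + (y ^ Fintype.card F - y) ^ (Fintype.card F - 1))
        / (y ^ Fintype.card F - y) ^ (Fintype.card F ^ 2 - 1) := by
  have hL := sub_ne_zero.2 hy
  have h0 : (y ^ Fintype.card F ^ 2) ^ Fintype.card F - y ^ Fintype.card F ^ 2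
      = (y ^ Fintype.card F - y) ^ Fintype.card F ^ 2 := by
    simp only [sq, pow_mul, sub_pow_fintype_card]
  have hy' : (y ^ Fintype.card F ^ 2) ^ Fintype.card F ≠ y ^ Fintype.card F ^ 2 := by
    rw [← sub_ne_zero, h0]; exact pow_ne_zero _ hL
  have h1 := pow_sub_one_mul (Fintype.card_ne_zero (α := F)) (y ^ Fintype.card F - y)
  have h2 := pow_card_sq_sub_self (F := F) y
  have h3 := pow_sub_one_mul (pow_ne_zero 2 (Fintype.card_ne_zero (α := F)))
    (y ^ Fintype.card F - y)
  simp only [add_algebraMap_pow_card_sq_sub_one hy, inv_div]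
  simp only [add_div, Finset.sum_add_distrib, sum_div_add_algebraMap hy', h0]
  simp only [div_eq_mul_inv, ← Finset.mul_sum, sum_inv_add_algebraMap hy', h0]
  rw [← h3]
  field_simp
  linear_combination h2 - h1

end Translates

/-! ### Closed forms of the numerator and the denominator -/

section ClosedForms

variable (F : Type*) [Field F] [Fintype F]

lemma X_pow_card_sub_X_eq_mul :
    (X ^ Fintype.card F - X : F[X]) = X * (X ^ (Fintype.card F - 1) - 1) := by
  rw [mul_sub, mul_one, mul_pow_sub_one Fintype.card_ne_zero]

lemma X_pow_card_sub_one_sub_one_ne_zero : (X ^ (Fintype.card F - 1) - 1 : F[X]) ≠ 0 := by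
  rw [← C_1]
  exact X_pow_sub_C_ne_zero (Nat.sub_pos_of_lt Fintype.one_lt_card) 1

lemma X_pow_card_sub_X_pow_card_sub_one :
    (X ^ Fintype.card F - X : F[X]) ^ (Fintype.card F - 1)
      = ∑ i ∈ Finset.range (Fintype.card F), (X ^ (Fintype.card F - 1)) ^ (i + 1) := by
  have h : (X ^ (Fintype.card F - 1) - 1 : F[X]) ^ (Fintype.card F - 1)
      = ∑ i ∈ Finset.range (Fintype.card F), (X ^ (Fintype.card F - 1)) ^ i := by
    apply mul_right_cancel₀ (X_pow_card_sub_one_sub_one_ne_zero F)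
    rw [geom_sum_mul, pow_sub_one_mul Fintype.card_ne_zero, sub_pow_fintype_card, one_pow]
  rw [X_pow_card_sub_X_eq_mul, mul_pow, h, Finset.mul_sum]
  simp only [pow_succ']

lemma one_add_X_pow_card_sub_X_pow_card_sub_one :
    1 + (X ^ Fintype.card F - X : F[X]) ^ (Fintype.card F - 1)
      = ∑ i ∈ Finset.range (Fintype.card F + 1), (X ^ (Fintype.card F - 1)) ^ i := by
  rw [X_pow_card_sub_X_pow_card_sub_one, Finset.sum_range_succ', pow_zero, add_comm]

lemma hPoly_eq :
    hPoly F (Fintype.card F)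
      = (X ^ Fintype.card F - X : F[X]) ^ (Fintype.card F * (Fintype.card F - 1)) := by
  rw [mul_comm, pow_mul, X_pow_card_sub_X_pow_card_sub_one, sum_pow_fintype_card, hPoly,
    Finset.range_eq_Ico, Finset.sum_Ico_add' (fun i => ((X ^ (Fintype.card F - 1) : F[X]) ^ i) ^ _)]
  refine Finset.sum_congr rfl fun i _ => ?_
  ring

omit [Fintype F] in
/-- The second sum collects the extra terms at the exponents with `θ = 2`. -/
lemma gPoly_eq_add (q : ℕ) (hq : 0 < q) :
    gPoly F q = ∑ i ∈ Finset.range (q * (q + 1) + 1), (X ^ (q - 1) : F[X]) ^ i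
      + ∑ k ∈ Finset.range q, (X ^ (q - 1) : F[X]) ^ (q * (k + 1)) := by
  have hsub : (Finset.Icc 1 q).image (fun j => j * q) ⊆ Finset.range (q * (q + 1) + 1) := by
    intro i hi
    simp only [Finset.mem_image, Finset.mem_Icc, Finset.mem_range] at hi ⊢
    obtain ⟨j, hj, rfl⟩ := hi
    nlinarith
  have hterm (i : ℕ) : C (theta q i : F) * X ^ (i * (q - 1)) = (X ^ (q - 1) : F[X]) ^ i
      + if i ∈ (Finset.Icc 1 q).image (fun j => j * q) then (X ^ (q - 1) : F[X]) ^ i else 0 := by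
    rw [theta, mul_comm i, pow_mul]
    split_ifs
    · simp [one_add_one_eq_two.symm, add_mul]
    · simp
  rw [gPoly, Finset.sum_congr rfl fun i _ => hterm i, Finset.sum_add_distrib,
    Finset.sum_ite_mem, Finset.inter_eq_right.2 hsub,
    Finset.sum_image fun a _ b _ h => Nat.eq_of_mul_eq_mul_right hq h, Finset.range_eq_Ico,
    Finset.range_eq_Ico, Finset.sum_Ico_add' (fun i => (X ^ (q - 1) : F[X]) ^ (q * i))]
  simp only [mul_comm q]
  rfl

lemma gPoly_eq :
    gPoly F (Fintype.card F)
      = (1 + (X ^ Fintype.card F - X : F[X]) ^ (Fintype.card F - 1)) ^ (Fintype.card F + 1) := by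
  have hq : 0 < Fintype.card F := Fintype.card_pos
  rw [gPoly_eq_add F _ hq, pow_succ, one_add_X_pow_card_sub_X_pow_card_sub_one,
    sum_pow_fintype_card]
  apply mul_right_cancel₀ (X_pow_card_sub_one_sub_one_ne_zero F)
  -- what remains is an identity of geometric sums in an arbitrary element `u`
  generalize (X ^ (Fintype.card F - 1) : F[X]) = u
  generalize Fintype.card F = q
  have h1 := geom_sum_mul u (q * (q + 1))
  have h2 := geom_sum_mul (u ^ q) (q + 1)
  have h3 := geom_sum_mul u q
  simp only [← pow_mul] at h2
  have h4 := Finset.sum_range_succ' (fun k => u ^ (q * k)) q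
  rw [mul_zero, pow_zero] at h4
  rw [Finset.sum_range_succ, Finset.sum_range_succ (fun i => u ^ i) q]
  simp only [← pow_mul, mul_comm _ q]
  linear_combination h1 - (∑ k ∈ Finset.range (q + 1), u ^ (q * k)) * h3 - u * h2 - (u - 1) * h4

end ClosedForms

/-! ### Automorphisms of the rational function field -/

section Automorphisms

variable {F : Type*} [Field F]

lemma num_denom_div_of_isCoprime {r s : F[X]} (h : IsCoprime r s) (hs : s.Monic) :
    (algebraMap F[X] (RatFunc F) r / algebraMap F[X] (RatFunc F) s).num = r ∧
      (algebraMap F[X] (RatFunc F) r / algebraMap F[X] (RatFunc F) s).denom = s := by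
  set f := algebraMap F[X] (RatFunc F) r / algebraMap F[X] (RatFunc F) s with hf
  have key : f.num * s = r * f.denom := (RatFunc.num_mul_eq_mul_denom_iff hs.ne_zero).2 hf
  have hd : f.denom = s := eq_of_monic_of_associated f.monic_denom hs <|
    associated_of_dvd_dvd (RatFunc.denom_div_dvd r s)
      (h.symm.dvd_of_dvd_mul_left (Dvd.intro_left _ key))
  rw [hd] at key
  exact ⟨mul_right_cancel₀ hs.ne_zero key, hd⟩

/-- By Lüroth's degree formula, `F(f) = F(x)` exactly when `f` has degree one. -/
lemma exists_ratAut_apply_X_eq_iff (f : RatFunc F) :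
    (∃ φ : RatAut F, φ RatFunc.X = f) ↔ max f.num.natDegree f.denom.natDegree = 1 := by
  rw [← RatFunc.finrank_eq_max_natDegree, IntermediateField.finrank_eq_one_iff_eq_top]
  constructor
  · rintro ⟨φ, rfl⟩
    have := IntermediateField.adjoin_map F {(RatFunc.X : RatFunc F)} (φ : RatFunc F →ₐ[F] RatFunc F)
    rw [RatFunc.adjoin_X, Set.image_singleton, AlgEquiv.coe_toAlgHom] at this
    rw [← this, ← AlgHom.fieldRange_eq_map, AlgHom.fieldRange_eq_top]
    exact φ.surjective
  · intro h
    have hf : Transcendental F f := by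
      apply RatFunc.transcendental_of_ne_C
      rintro ⟨c, rfl⟩
      rw [adjoin_simple_eq_bot_iff.mpr (show RatFunc.C c ∈ _ from ⟨c, rfl⟩)] at h
      obtain ⟨a, ha⟩ := IntermediateField.mem_bot.1 (h ▸ mem_top : (RatFunc.X : RatFunc F) ∈ _)
      have := congrArg RatFunc.num ha
      simp at this
      exact X_ne_C a this.symm
    refine ⟨(RatFunc.algEquivOfTranscendental f hf).trans
      ((equivOfEq h).trans topEquiv), ?_⟩
    simp

lemma ratAut_apply_X_injective :
    Function.Injective fun φ : RatAut F => φ (RatFunc.X : RatFunc F) := by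
  intro φ ψ h
  have hp (p : F[X]) : φ (algebraMap F[X] (RatFunc F) p) = ψ (algebraMap F[X] (RatFunc F) p) := by
    simp only [← RatFunc.aeval_X_left_eq_algebraMap]
    rw [← aeval_algHom_apply, ← aeval_algHom_apply]
    exact congrArg (fun z => aeval z p) h
  ext f
  rw [← RatFunc.num_div_denom f, map_div₀, map_div₀, hp, hp]

/-- Representatives for the images of `x` under `Aut(F(x)/F)` up to affine substitutions:
`x` itself (for `none`) and the `1 / (x + d)` (for `some d`). -/
noncomputable def affineRep : Option F → RatFunc F
  | none => RatFunc.X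
  | some d => (RatFunc.X + algebraMap F (RatFunc F) d)⁻¹

/-- The element `u (y + a)` of `F(x)`, where `y` is the representative `affineRep o`.
Every fractional linear expression in `x` has exactly one such form. -/
noncomputable def fractionalLinear (t : Fˣ × F × Option F) : RatFunc F :=
  algebraMap F (RatFunc F) t.1 * (affineRep t.2.2 + algebraMap F (RatFunc F) t.2.1)

lemma num_denom_fractionalLinear_none (u : Fˣ) (a : F) :
    (fractionalLinear (u, a, none)).num = C (u : F) * (X + C a) ∧
      (fractionalLinear (u, a, none)).denom = 1 := by
  have : fractionalLinear (u, a, none)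
      = algebraMap F[X] (RatFunc F) (C (u : F) * (X + C a)) / algebraMap F[X] (RatFunc F) 1 := by
    simp [fractionalLinear, affineRep]
  rw [this]
  exact num_denom_div_of_isCoprime isCoprime_one_right monic_one

lemma num_denom_fractionalLinear_some (u : Fˣ) (a d : F) :
    (fractionalLinear (u, a, some d)).num = C (u : F) * (1 + C a * (X + C d)) ∧
      (fractionalLinear (u, a, some d)).denom = X + C d := by
  have hd : algebraMap F[X] (RatFunc F) (X + C d) ≠ 0 :=
    RatFunc.algebraMap_ne_zero (X_add_C_ne_zero d)
  have : fractionalLinear (u, a, some d)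
      = algebraMap F[X] (RatFunc F) (C (u : F) * (1 + C a * (X + C d)))
        / algebraMap F[X] (RatFunc F) (X + C d) := by
    rw [eq_div_iff hd]
    simp [fractionalLinear, affineRep] at hd ⊢
    field_simp
  rw [this]
  refine num_denom_div_of_isCoprime ?_ (monic_X_add_C d)
  refine (isCoprime_mul_unit_left_left (isUnit_C.2 u.isUnit) _ _).2 ?_
  exact ⟨1, -C a, by ring⟩

lemma fractionalLinear_injective :
    Function.Injective (fractionalLinear : Fˣ × F × Option F → RatFunc F) := by
  rintro ⟨u, a, _ | d⟩ ⟨v, b, _ | e⟩ h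
  · have hn := congrArg RatFunc.num h
    rw [(num_denom_fractionalLinear_none u a).1, (num_denom_fractionalLinear_none v b).1] at hn
    have h1 := congrArg (fun r => r.coeff 1) hn
    have h0 := congrArg (fun r => r.coeff 0) hn
    simp [coeff_X, coeff_C] at h1 h0
    obtain rfl : u = v := Units.ext h1
    simpa using h0
  · have hd := congrArg RatFunc.denom h
    rw [(num_denom_fractionalLinear_none u a).2, (num_denom_fractionalLinear_some v b e).2] at hd
    simpa using congrArg natDegree hd
  · have hd := congrArg RatFunc.denom h
    rw [(num_denom_fractionalLinear_some u a d).2, (num_denom_fractionalLinear_none v b).2] at hd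
    simpa using congrArg natDegree hd
  · have hd := congrArg RatFunc.denom h
    have hn := congrArg RatFunc.num h
    rw [(num_denom_fractionalLinear_some u a d).2, (num_denom_fractionalLinear_some v b e).2] at hd
    obtain rfl : d = e := C_injective (add_left_cancel hd)
    rw [(num_denom_fractionalLinear_some u a d).1, (num_denom_fractionalLinear_some v b d).1] at hn
    have h0 := congrArg (eval (-d)) hn
    have h1 := congrArg (fun r => r.coeff 1) hn
    simp [coeff_X, coeff_one] at h0 h1
    obtain rfl : u = v := Units.ext h0
    simpa using h1

lemma exists_fractionalLinear_eq_iff (f : RatFunc F) :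
    (∃ t, fractionalLinear t = f) ↔ max f.num.natDegree f.denom.natDegree = 1 := by
  constructor
  · rintro ⟨⟨u, a, _ | d⟩, rfl⟩
    · rw [(num_denom_fractionalLinear_none u a).1, (num_denom_fractionalLinear_none u a).2,
        natDegree_C_mul u.ne_zero]
      simp
    · rw [(num_denom_fractionalLinear_some u a d).1, (num_denom_fractionalLinear_some u a d).2,
        natDegree_C_mul u.ne_zero, natDegree_X_add_C, max_eq_right]
      compute_degree
  · intro h
    have hext {g : RatFunc F} (h1 : g.num = f.num) (h2 : g.denom = f.denom) : g = f := by
      rw [← RatFunc.num_div_denom g, ← RatFunc.num_div_denom f, h1, h2]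
    obtain ⟨a, b, hn⟩ := exists_eq_X_add_C_of_natDegree_le_one ((le_max_left _ _).trans h.le)
    obtain hd | hd := Nat.le_one_iff_eq_zero_or_eq_one.1 ((le_max_right _ _).trans h.le)
    · have hd1 := f.monic_denom.natDegree_eq_zero.1 hd
      have ha : a ≠ 0 := by
        rintro rfl
        rw [hd, hn] at h
        simp at h
      refine ⟨(Units.mk0 a ha, b / a, none), hext ?_ ?_⟩
      · rw [(num_denom_fractionalLinear_none _ _).1, hn, mul_add, ← C_mul, Units.val_mk0,
          mul_div_cancel₀ _ ha]
      · rw [(num_denom_fractionalLinear_none _ _).2, hd1]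
    · obtain ⟨d, hd1⟩ : ∃ d, f.denom = X + C d := ⟨_, f.monic_denom.eq_X_add_C hd⟩
      have hu : b - a * d ≠ 0 := by
        intro h0
        have hc := f.isCoprime_num_denom
        have : f.num = C a * f.denom := by
          rw [hn, hd1, sub_eq_zero.1 h0, C_mul]; ring
        rw [this, IsCoprime.mul_left_iff] at hc
        have := natDegree_eq_zero_of_isUnit (isCoprime_self.1 hc.2)
        omega
      refine ⟨(Units.mk0 (b - a * d) hu, a / (b - a * d), some d), hext ?_ ?_⟩
      · rw [(num_denom_fractionalLinear_some _ _ _).1, hn, mul_add, ← mul_assoc, ← C_mul,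
          Units.val_mk0, mul_div_cancel₀ _ hu, C_sub, C_mul]
        ring
      · rw [(num_denom_fractionalLinear_some _ _ _).2, hd1]

variable (F) in
/-- `Aut(F(x)/F)` as a set: an automorphism is determined by the image of `x`, which can be any
fractional linear expression. -/
noncomputable def ratAutEquiv : RatAut F ≃ Fˣ × F × Option F :=
  (Equiv.ofInjective _ ratAut_apply_X_injective).trans <|
    (Equiv.setCongr (Set.ext fun f => (exists_ratAut_apply_X_eq_iff f).trans
      (exists_fractionalLinear_eq_iff f).symm)).trans
    (Equiv.ofInjective _ fractionalLinear_injective).symm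

lemma fractionalLinear_ratAutEquiv (φ : RatAut F) :
    fractionalLinear (ratAutEquiv F φ) = φ RatFunc.X :=
  Equiv.apply_ofInjective_symm fractionalLinear_injective _

instance finite_ratAut [Finite F] : Finite (RatAut F) :=
  Finite.of_equiv _ (ratAutEquiv F).symm

end Automorphisms

/-! ### The generator of the fixed field -/

section Generator

variable (F : Type*) [Field F] [Fintype F]

lemma X_pow_card_ne_X : (RatFunc.X : RatFunc F) ^ Fintype.card F ≠ RatFunc.X := by
  rw [← sub_ne_zero, ← RatFunc.algebraMap_X, ← map_pow, ← map_sub]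
  exact RatFunc.algebraMap_ne_zero (FiniteField.X_pow_card_sub_X_ne_zero F Fintype.one_lt_card)

/-- The unit factor `u` disappears in the power `q ^ 2 - 1`, so the sum over `u` contributes the
factor `q - 1 = -1`. -/
lemma fSum_eq_neg_sum :
    fSum F (Fintype.card F ^ 2 - 1) = -∑ o : Option F, ∑ a : F,
      (affineRep o + algebraMap F (RatFunc F) a) ^ (Fintype.card F ^ 2 - 1) := by
  classical
  have hu (u : Fˣ) : algebraMap F (RatFunc F) u ^ (Fintype.card F ^ 2 - 1) = 1 := by
    rw [← map_pow, ← one_pow 2, Nat.sq_sub_sq, mul_comm, pow_mul,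
      FiniteField.pow_card_sub_one_eq_one _ u.ne_zero, one_pow, map_one]
  have hcard : (Fintype.card Fˣ : RatFunc F) = -1 := by
    rw [Fintype.card_units, Nat.cast_sub Fintype.card_pos, cast_fintype_card_eq_zero F]
    simp
  have := Fintype.ofFinite (RatAut F)
  rw [fSum, finsum_eq_sum_of_fintype]
  simp only [← fractionalLinear_ratAutEquiv]
  rw [(ratAutEquiv F).sum_comp (fun t => fractionalLinear t ^ (Fintype.card F ^ 2 - 1)),
    Fintype.sum_prod_type]
  simp only [Fintype.sum_prod_type_right, fractionalLinear, mul_pow, hu, one_mul]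
  rw [Finset.sum_const, Finset.card_univ, nsmul_eq_mul, hcard, neg_one_mul]

lemma fSum_eq_pow_div_pow :
    fSum F (Fintype.card F ^ 2 - 1)
      = (1 + (RatFunc.X ^ Fintype.card F - RatFunc.X) ^ (Fintype.card F - 1))
          ^ (Fintype.card F + 1)
        / (RatFunc.X ^ Fintype.card F - RatFunc.X) ^ (Fintype.card F * (Fintype.card F - 1)) := by
  have hX := X_pow_card_ne_X F
  have hL := sub_ne_zero.2 hX
  have hz (d : F) := add_algebraMap_ne_zero hX d
  have hq := Fintype.card_pos (α := F)
  -- `L (1 / z) = - L (x) / z ^ (q + 1)` for `z = x + d` and `L (y) = y ^ q - y`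
  have hrep (d : F) : affineRep (some d) ^ Fintype.card F - affineRep (some d)
      = -((RatFunc.X ^ Fintype.card F - RatFunc.X)
        / (RatFunc.X + algebraMap F (RatFunc F) d) ^ (Fintype.card F + 1)) := by
    have h := add_pow_fintype_card (F := F) RatFunc.X (algebraMap F (RatFunc F) d)
    rw [algebraMap_pow_fintype_card] at h
    have := hz d
    rw [affineRep, pow_succ, inv_pow]
    field_simp
    rw [h]
    ring
  have hne : ∀ o, (affineRep o : RatFunc F) ^ Fintype.card F ≠ affineRep o := by
    rintro (_ | d)
    · exact hX
    · rw [← sub_ne_zero, hrep]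
      exact neg_ne_zero.2 (div_ne_zero hL (pow_ne_zero _ (hz d)))
  have hneg : (-1 : RatFunc F) ^ (Fintype.card F - 1) = 1 := by
    rw [← map_one (algebraMap F (RatFunc F)), ← map_neg, ← map_pow,
      FiniteField.pow_card_sub_one_eq_one _ (neg_ne_zero.2 one_ne_zero)]
  have hsq : (Fintype.card F + 1) * (Fintype.card F - 1) = Fintype.card F ^ 2 - 1 := by
    rw [← Nat.sq_sub_sq, one_pow]
  have hsq' : Fintype.card F ^ 2 - 1
      = (Fintype.card F - 1) + Fintype.card F * (Fintype.card F - 1) := by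
    rw [← hsq]; ring
  rw [fSum_eq_neg_sum, ← Finset.sum_neg_distrib]
  simp only [sum_add_algebraMap_pow (hne _), neg_neg]
  rw [Fintype.sum_option]
  simp only [hrep, neg_pow (_ / _), hneg, one_mul, div_pow, ← pow_mul, hsq]
  simp only [div_eq_mul_inv, Finset.sum_add_distrib, ← Finset.mul_sum,
    sum_inv_add_algebraMap_pow hX]
  rw [affineRep, Finset.sum_const, Finset.card_univ, nsmul_eq_mul, cast_fintype_card_eq_zero F,
    hsq', pow_succ _ (Fintype.card F), add_pow_fintype_card, ← pow_mul, mul_comm (_ - 1), pow_add]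
  have := pow_ne_zero (Fintype.card F - 1) hL
  have := pow_ne_zero (Fintype.card F * (Fintype.card F - 1)) hL
  field_simp
  ring

lemma fSum_eq_div :
    fSum F (Fintype.card F ^ 2 - 1) = algebraMap F[X] (RatFunc F) (gPoly F (Fintype.card F))
      / algebraMap F[X] (RatFunc F) (hPoly F (Fintype.card F)) := by
  rw [fSum_eq_pow_div_pow, gPoly_eq, hPoly_eq]
  simp

lemma isCoprime_gPoly_hPoly :
    IsCoprime (gPoly F (Fintype.card F)) (hPoly F (Fintype.card F)) := by
  rw [gPoly_eq, hPoly_eq]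
  apply IsCoprime.pow
  obtain ⟨k, hk⟩ := Nat.exists_eq_succ_of_ne_zero
    (Nat.sub_pos_of_lt (Fintype.one_lt_card (α := F))).ne'
  exact ⟨1, -(X ^ Fintype.card F - X) ^ k, by rw [hk, Nat.succ_eq_add_one]; ring⟩

lemma monic_X_pow_card_sub_X : (X ^ Fintype.card F - X : F[X]).Monic :=
  monic_X_pow_sub (by rw [degree_X]; exact_mod_cast Fintype.one_lt_card)

lemma monic_hPoly : (hPoly F (Fintype.card F)).Monic := by
  rw [hPoly_eq]
  exact (monic_X_pow_card_sub_X F).pow _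

lemma natDegree_hPoly :
    (hPoly F (Fintype.card F)).natDegree
      = Fintype.card F * (Fintype.card F - 1) * Fintype.card F := by
  rw [hPoly_eq, natDegree_pow, FiniteField.X_pow_card_sub_X_natDegree_eq F Fintype.one_lt_card]

lemma natDegree_gPoly :
    (gPoly F (Fintype.card F)).natDegree
      = (Fintype.card F + 1) * ((Fintype.card F - 1) * Fintype.card F) := by
  have h : ((X ^ Fintype.card F - X : F[X]) ^ (Fintype.card F - 1)).natDegree
      = (Fintype.card F - 1) * Fintype.card F := by
    rw [natDegree_pow, FiniteField.X_pow_card_sub_X_natDegree_eq F Fintype.one_lt_card]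
  have hpos : 0 < (Fintype.card F - 1) * Fintype.card F :=
    Nat.mul_pos (Nat.sub_pos_of_lt Fintype.one_lt_card) Fintype.card_pos
  rw [gPoly_eq, natDegree_pow, natDegree_add_eq_right_of_natDegree_lt, h]
  rwa [h, natDegree_one]

lemma finrank_adjoin_fSum :
    Module.finrank F⟮fSum F (Fintype.card F ^ 2 - 1)⟯ (RatFunc F) = Nat.card (RatAut F) := by
  have h := num_denom_div_of_isCoprime (isCoprime_gPoly_hPoly F) (monic_hPoly F)
  rw [← fSum_eq_div] at h
  rw [RatFunc.finrank_eq_max_natDegree, h.1, h.2, natDegree_gPoly, natDegree_hPoly, max_eq_left,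
    Nat.card_congr (ratAutEquiv F)]
  · classical
    rw [Nat.card_eq_fintype_card, Fintype.card_prod, Fintype.card_prod, Fintype.card_option,
      Fintype.card_units]
    ring
  · nlinarith [Nat.zero_le ((Fintype.card F - 1) * Fintype.card F)]

/-- Artin's theorem for the finite group `Aut(F(x)/F)`. -/
lemma finrank_fixedE : Module.finrank (fixedE F) (RatFunc F) = Nat.card (RatAut F) := by
  have := Fintype.ofFinite (⊤ : Subgroup (RatAut F))
  rw [← Nat.card_congr (Subgroup.topEquiv (G := RatAut F)).toEquiv, Nat.card_eq_fintype_card]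
  exact FixedPoints.finrank_eq_card (⊤ : Subgroup (RatAut F)) (RatFunc F)

lemma fSum_mem_fixedE (k : ℕ) : fSum F k ∈ fixedE F := by
  rw [fixedE, mem_fixedField_iff]
  intro φ _
  have := Fintype.ofFinite (RatAut F)
  rw [fSum, finsum_eq_sum_of_fintype, map_sum]
  simp only [map_pow]
  exact Equiv.sum_comp (Equiv.mulLeft φ) fun ψ : RatAut F => ψ RatFunc.X ^ k

lemma fixedE_eq_adjoin_fSum : fixedE F = F⟮fSum F (Fintype.card F ^ 2 - 1)⟯ := by
  have : FiniteDimensional F⟮fSum F (Fintype.card F ^ 2 - 1)⟯ (RatFunc F) :=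
    Module.finite_of_finrank_pos (by rw [finrank_adjoin_fSum]; exact Nat.card_pos)
  exact (eq_of_le_of_finrank_eq' (adjoin_simple_le_iff.2 (fSum_mem_fixedE F _))
    ((finrank_adjoin_fSum F).trans (finrank_fixedE F).symm)).symm

lemma fSum_mem_adjoin_X (k : Type*) [Field k] [Algebra k F] :
    fSum F (Fintype.card F ^ 2 - 1) ∈ k⟮(RatFunc.X : RatFunc F)⟯ := by
  have hX : (RatFunc.X : RatFunc F) ∈ k⟮(RatFunc.X : RatFunc F)⟯ := mem_adjoin_simple_self _ _
  rw [fSum_eq_pow_div_pow]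
  have hL := pow_mem hX (Fintype.card F)
  exact div_mem (pow_mem (add_mem (one_mem _) (pow_mem (sub_mem hL hX) _)) _)
    (pow_mem (sub_mem hL hX) _)

end Generator

theorem theorem2 (p n q : ℕ) [Fact p.Prime] (hn : 1 ≤ n) (hq : q = p ^ n)
    (F : Type*) [Field F] [Finite F] [Algebra (ZMod p) F] (hF : Nat.card F = q) :
    Finite (RatAut F) ∧
    IsCoprime (gPoly F q) (hPoly F q) ∧
    hPoly F q ≠ 0 ∧
    fSum F (q ^ 2 - 1) =
      algebraMap F[X] (RatFunc F) (gPoly F q) / algebraMap F[X] (RatFunc F) (hPoly F q) ∧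
    fixedE F = F⟮fSum F (q ^ 2 - 1)⟯ ∧
    fSum F (q ^ 2 - 1) ∈ (ZMod p)⟮(RatFunc.X : RatFunc F)⟯ := by
  cases nonempty_fintype F
  rw [Nat.card_eq_fintype_card] at hF
  subst hF
  exact ⟨inferInstance, isCoprime_gPoly_hPoly F, (monic_hPoly F).ne_zero, fSum_eq_div F,
    fixedE_eq_adjoin_fSum F, fSum_mem_adjoin_X F (ZMod p)⟩
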